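/- Let $\mathcal H$ be a separable complex Hilbert space and let $\mathcal A\subseteq\mathcal B(\mathcal H)$ be a type I factor: $\mathcal A$ is a $*$-subalgebra containing $1$ with $\mathcal A=\mathcal A''$, $\mathcal A\cap\mathcal A'=\mathbb C 1$, and $\mathcal A$ contains a nonzero minimal projector, i.e. a projector $P=P^2=P^*\in\mathcal A$, $P\neq 0$, such that no nonzero projector $Q\in\mathcal A$ satisfies $Q\lneq P$. Projectors $Q,P\in\mathcal A$ are equivalent, $Q\sim P$, if there is $V\in\mathcal A$ with $V^*V=Q$ and $VV^*=P$. The factor $\mathcal A$ is of type I$_n$ ($n\in\mathbb N\cup\{\infty\}$) if some maximal set of pairwise orthogonal nonzero minimal projectors of $\mathcal A$ has exactly $n$ elements. Then there is exactly one $n\in\mathbb N\cup\{\infty\}$ such that $\mathcal A$ is of type I$_n$. Moreover, for this $n$ and for every nonzero minimal projector $P$ of $\mathcal A$, there is a maximal set of pairwise orthogonal projectors of $\mathcal A$ that are equivalent to $P$, and every such maximal set $\{P_j\}_{j\in J}$ has the following properties. 1. $J$ is countable and has exactly $n$ elements; every $P_j$ is a nonzero minimal projector of $\mathcal A$; and $\sum_j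 P_j=1$, i.e. $\sum_j P_jx=x$ (unconditionally) for all $x\in\mathcal H$. 2. For every choice of $V_j\in\mathcal A$ with $V_j^*V_j=P_j$ and $V_jV_j^*=P$ $(j\in J)$: (a) for every $T\in\mathcal A$ and all $j,k\in J$, the operator $V_jTV_k^*$ is a complex scalar multiple of $P$; (b) let $\mathcal H'=\ell^2(J)$, a Hilbert space of dimension $n$ with orthonormal basis $(e_j)_{j\in J}$ labelled by the projectors $P_j$. There is a unitary $U:\mathcal H\to\mathcal H'\otimes P\mathcal H$ (Hilbert space tensor product) with $U(V_j^*x)=e_j\otimes x$ for all $j\in J$ and $x\in P\mathcal H$, and $$U\mathcal A U^*=\mathcal B(\mathcal H')\otimes 1_{P\mathcal H}=\{S\otimes 1_{P\mathcal H}: S\in\mathcal B(\mathcal H')\}.$$ -/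

import Mathlib

open scoped TensorProduct InnerProductSpace

noncomputable section

namespace VonNeumannAlgebra

variable {H : Type*} [NormedAddCommGroup H] [InnerProductSpace ℂ H] [CompleteSpace H]

/-- A von Neumann algebra is a factor if its center consists of the scalar multiples of `1`. -/
def IsFactor (A : VonNeumannAlgebra H) : Prop :=
  ∀ T ∈ A, T ∈ A.commutant → ∃ c : ℂ, T = c • (1 : H →L[ℂ] H)

/-- `P` is an (orthogonal) projector belonging to `A`. -/
def IsProjector (A : VonNeumannAlgebra H) (P : H →L[ℂ] H) : Prop :=
  P ∈ A ∧ IsStarProjection P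

/-- `P` is a nonzero minimal projector of `A`: there is no nonzero projector of `A` strictly
below `P`. -/
def IsMinimalProjector (A : VonNeumannAlgebra H) (P : H →L[ℂ] H) : Prop :=
  A.IsProjector P ∧ P ≠ 0 ∧ ∀ Q, A.IsProjector Q → Q ≠ 0 → ¬ Q < P

/-- `V` is a partial isometry in `A` with initial projector `P` and final projector `Q`. -/
def ImplementsEquiv (A : VonNeumannAlgebra H) (V P Q : H →L[ℂ] H) : Prop :=
  V ∈ A ∧ star V * V = P ∧ V * star V = Q

/-- Equivalence of projectors relative to `A`. -/
def ProjectorEquiv (A : VonNeumannAlgebra H) (P Q : H →L[ℂ] H) : Prop :=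
  ∃ V, A.ImplementsEquiv V P Q

/-- A factor is of type I if it contains a nonzero minimal projector. -/
def IsTypeIFactor (A : VonNeumannAlgebra H) : Prop :=
  A.IsFactor ∧ ∃ P, A.IsMinimalProjector P

/-- A set of pairwise orthogonal nonzero minimal projectors of `A`. -/
def IsOrthogonalMinimalSet (A : VonNeumannAlgebra H) (s : Set (H →L[ℂ] H)) : Prop :=
  (∀ Q ∈ s, A.IsMinimalProjector Q) ∧ s.Pairwise fun Q R => Q * R = 0

/-- A factor of type I is of type `I_n` if some maximal set of pairwise orthogonal nonzero minimal
projectors has exactly `n` elements (`n = ⊤` means infinitely many). -/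
def IsTypeIFactorOfIndex (A : VonNeumannAlgebra H) (n : ℕ∞) : Prop :=
  A.IsTypeIFactor ∧ ∃ s, Maximal A.IsOrthogonalMinimalSet s ∧ s.encard = n

/-- A set of pairwise orthogonal projectors of `A`, each of them equivalent to `P`. -/
def IsOrthogonalCopies (A : VonNeumannAlgebra H) (P : H →L[ℂ] H) (F : Set (H →L[ℂ] H)) : Prop :=
  (∀ Q ∈ F, A.IsProjector Q ∧ A.ProjectorEquiv Q P) ∧ F.Pairwise fun Q R => Q * R = 0

end VonNeumannAlgebra

namespace HilbertTensor

variable (E F : Type*) [NormedAddCommGroup E] [InnerProductSpace ℂ E]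
  [NormedAddCommGroup F] [InnerProductSpace ℂ F]

/-- The Hilbert space tensor product of `E` and `F`: the completion of the algebraic tensor product
for the inner product `⟪a ⊗ b, c ⊗ d⟫ = ⟪a, c⟫ * ⟪b, d⟫`. -/
abbrev Space : Type _ := UniformSpace.Completion (E ⊗[ℂ] F)

variable {E F}

/-- The elementary tensor `x ⊗ y` in the Hilbert space tensor product. -/
def tmul (x : E) (y : F) : Space E F := ((x ⊗ₜ[ℂ] y : E ⊗[ℂ] F) : Space E F)

variable (F)

/-- The bounded operator `S ⊗ 1` on the Hilbert space tensor product of `E` and `F`. -/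
def ampliation (S : E →L[ℂ] E) : Space E F →L[ℂ] Space E F :=
  (UniformSpace.Completion.toComplL.comp (S.rTensor F)).extend
    (UniformSpace.Completion.toComplL : (E ⊗[ℂ] F) →L[ℂ] Space E F)

variable {F}

theorem ampliation_coe (S : E →L[ℂ] E) (z : E ⊗[ℂ] F) :
    ampliation F S (z : Space E F) = (S.rTensor F z : E ⊗[ℂ] F) :=
  ContinuousLinearMap.extend_eq _ UniformSpace.Completion.denseRange_coe
    (UniformSpace.Completion.isUniformInducing_coe _) z

theorem ampliation_tmul (S : E →L[ℂ] E) (x : E) (y : F) :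
    ampliation F S (tmul x y) = tmul (S x) y :=
  ampliation_coe S _

end HilbertTensor

/-- The Hilbert space `ℓ²(F)`, with orthonormal basis labelled by the elements of `F`. -/
abbrev LabelSpace {α : Type*} (F : Set α) : Type _ := lp (fun _ : F => ℂ) 2

open Classical in
/-- The basis vector of `ℓ²(F)` labelled by `j ∈ F`. -/
def labelVector {α : Type*} {F : Set α} (j : F) : LabelSpace F := lp.single 2 j (1 : ℂ)

end

/-!
Everything follows from two facts about a minimal projector `P` of a factor `A`.

The corner `P A P` is one-dimensional (`IsMinimalProjector.exists_eq_smul`). The closed range of an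
element of `A` is the range of a projector of `A`, so the corner has no zero divisors. Hence one of
the positive and negative parts of a self-adjoint element `S` of the corner vanishes. Applied to
`S - r P` for all real `r`, this makes `S` a multiple of `P`.

For projectors `P, Q ≠ 0` some `T ∈ A` has `Q T P ≠ 0` (`IsFactor.exists_mul_mul_ne_zero`), because
the closed span of `A P H` reduces both `A` and its commutant. As `(Q T P)* (Q T P)` lies in the
corner of `P`, a multiple of `Q T P` is a partial isometry with initial projector `P`. So each
nonzero projector dominates a copy of `P`, and the copies of `P` are exactly the minimal projectors
(`IsFactor.isOrthogonalCopies_eq`).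

A maximal orthogonal family `F` of minimal projectors therefore sums to `1`. Choose partial
isometries `V_Q ∈ A` from `Q ∈ F` onto `P`; the entries `V_Q T V_R^*` of `T ∈ A` are scalar. For a
unit vector `x ∈ P H` the vectors `V_Q^* x` form an orthonormal basis of the closure of `A x`, which
determines the number of elements of `F` (`IsMatrixUnits.encard_le`). Since `H` is the Hilbert sum
of the spaces `V_Q^* P H` and `ℓ²(F) ⊗ P H` is that of the spaces `e_Q ⊗ P H`, there is a unitary
`U` with `U (V_Q^* x) = e_Q ⊗ x`. It turns `A` into operators on the left factor since the matrix
entries are scalar, and it turns the commutant into operators on the right factor, so that, by the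
bicommutant property, every operator on the left factor comes from `A`.
-/

namespace VonNeumannAlgebra

variable {H : Type*} [NormedAddCommGroup H] [InnerProductSpace ℂ H] [CompleteSpace H]
  {A : VonNeumannAlgebra H} {P Q R V S T X Y : H →L[ℂ] H}

/-! ### Projectors of a von Neumann algebra -/

theorem smul_mem (c : ℂ) (hT : T ∈ A) : c • T ∈ A :=
  A.toStarSubalgebra.smul_mem hT c

theorem mem_of_forall_commutant (h : ∀ B ∈ A.commutant, B * T = T * B) : T ∈ A := by
  rw [← commutant_commutant A]
  exact mem_commutant_iff.2 h

theorem commutant_commute {B : H →L[ℂ] H} (hB : B ∈ A.commutant) (hT : T ∈ A) (x : H) :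
    T (B x) = B (T x) :=
  congr($(mem_commutant_iff.1 hB T hT) x)

/-- A closed subspace invariant under the commutant of `A` is the range of a projector of `A`. -/
theorem isProjector_starProjection (K : Submodule ℂ H) [K.HasOrthogonalProjection]
    (hK : ∀ B ∈ A.commutant, ∀ x ∈ K, B x ∈ K) : A.IsProjector K.starProjection := by
  refine ⟨(IsStarProjection.mem_iff isStarProjection_starProjection A).2 fun B hB => ?_,
    isStarProjection_starProjection⟩
  rw [Submodule.range_starProjection]
  exact fun x hx => hK B hB x hx

theorem IsProjector.mul_self (hP : A.IsProjector P) : P * P = P := hP.2.isIdempotentElem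

theorem IsProjector.star_eq (hP : A.IsProjector P) : star P = P := hP.2.isSelfAdjoint

theorem IsMinimalProjector.eq_of_mul_eq (hP : A.IsMinimalProjector P) (hQ : A.IsProjector Q)
    (hQ0 : Q ≠ 0) (h : P * Q = Q) : Q = P := by
  have hle : Q ≤ P := (hQ.2.le_iff_mul_eq_right hP.1.2).2 h
  exact hle.eq_of_not_lt (hP.2.2 Q hQ hQ0)

/-! ### The corner of a minimal projector is one-dimensional -/

/-- The corner `P A P` of a minimal projector has no zero divisors: the closed range of `Y ≠ 0` is
the range of a projector of `A` below `P`, hence equal to the range of `P`. -/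
theorem IsMinimalProjector.eq_zero_or_eq_zero (hP : A.IsMinimalProjector P) (hY : Y ∈ A)
    (hXP : X * P = X) (hPY : P * Y = Y) (h : X * Y = 0) : X = 0 ∨ Y = 0 := by
  by_cases hY0 : Y = 0
  · exact .inr hY0
  left
  set K := Y.range.topologicalClosure
  have hE : A.IsProjector K.starProjection := by
    refine isProjector_starProjection K fun B hB => fun _ hx => ?_
    refine map_mem_closure B.continuous hx ?_
    rintro _ ⟨y, rfl⟩
    exact ⟨B y, commutant_commute hB hY y⟩
  have hmem (y : H) : Y y ∈ K := Y.range.le_topologicalClosure ⟨y, rfl⟩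
  have hEY : K.starProjection * Y = Y := by
    ext y
    exact Submodule.starProjection_eq_self_iff.2 (hmem y)
  -- Operators that agree on the range of `Y` agree on its closure.
  have hclosed (Z W : H →L[ℂ] H) (hZ : Z * Y = W * Y) :
      Z * K.starProjection = W * K.starProjection := by
    have : K ≤ (LinearMap.eqLocus Z.toLinearMap W.toLinearMap) := by
      refine Submodule.topologicalClosure_minimal _ ?_ (isClosed_eq Z.continuous W.continuous)
      rintro _ ⟨y, rfl⟩
      exact congr($hZ y)
    ext x
    exact this (Submodule.starProjection_apply_mem K x)
  have hEP : K.starProjection = P := by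
    refine hP.eq_of_mul_eq hE ?_ ?_
    · intro h0
      rw [h0, zero_mul] at hEY
      exact hY0 hEY.symm
    · simpa using hclosed P 1 (by simpa using hPY)
  have := hclosed X 0 (by simpa using h)
  rw [hEP, hXP, zero_mul] at this
  exact this

/-- No self-adjointness is needed: otherwise `cfc f T` is the junk value `0`. -/
theorem cfc_mem (f : ℝ → ℝ) (hT : T ∈ A) : cfc f T ∈ A := by
  refine mem_of_forall_commutant fun B hB => ?_
  have : Commute T B := mem_commutant_iff.1 hB T hT
  exact (this.cfc_real f).symm.eq

theorem negPart_mem (hT : T ∈ A) : T⁻ ∈ A := by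
  rw [CFC.negPart_def, cfcₙ_eq_cfc]
  exact cfc_mem _ hT

/-- The self-adjoint elements of the corner of a minimal projector are positive or negative. -/
theorem IsMinimalProjector.nonneg_or_nonpos (hP : A.IsMinimalProjector P) (hS : S ∈ A)
    (hs : IsSelfAdjoint S) (hPS : P * S = S) : 0 ≤ S ∨ S ≤ 0 := by
  have hSP : S * P = S := by
    simpa [hs.star_eq, hP.1.star_eq] using congr(star $hPS)
  have hc : Commute S P := hSP.trans hPS.symm
  have hcp : Commute S⁺ P := by
    rw [CFC.posPart_def, cfcₙ_eq_cfc]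
    exact hc.cfc_real _
  have hcn : Commute S⁻ P := by
    rw [CFC.negPart_def, cfcₙ_eq_cfc]
    exact hc.cfc_real _
  have hPP := hP.1.mul_self
  have hdec : S = S⁺ * P - S⁻ * P := by
    rw [← sub_mul, CFC.posPart_sub_negPart S hs, hSP]
  have hp : 0 ≤ S⁺ * P := by
    have := hP.1.2.isSelfAdjoint.conjugate_nonneg (CFC.posPart_nonneg S)
    rwa [← hcp.eq, mul_assoc, hPP] at this
  have hn : 0 ≤ S⁻ * P := by
    have := hP.1.2.isSelfAdjoint.conjugate_nonneg (CFC.negPart_nonneg S)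
    rwa [← hcn.eq, mul_assoc, hPP] at this
  rcases hP.eq_zero_or_eq_zero (X := S⁺ * P) (Y := S⁻ * P) (mul_mem (negPart_mem hS) hP.1.1)
    (by rw [mul_assoc, hPP]) (by rw [hcn.eq, ← mul_assoc, hPP])
    (by rw [hcn.eq, mul_assoc, ← mul_assoc P, hPP, ← mul_assoc, hcp.eq, mul_assoc,
      CFC.posPart_mul_negPart, mul_zero]) with h | h
  · right
    rw [hdec, h, zero_sub]
    exact neg_nonpos.2 hn
  · left
    rw [hdec, h, sub_zero]
    exact hp

theorem IsProjector.exists_unit (hP : A.IsProjector P) (h0 : P ≠ 0) : ∃ x, P x = x ∧ ‖x‖ = 1 := by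
  obtain ⟨y, hy⟩ : ∃ y, P y ≠ 0 := by
    by_contra! h
    exact h0 (by ext y; simpa using h y)
  refine ⟨((‖P y‖⁻¹ : ℝ) : ℂ) • P y, ?_, ?_⟩
  · rw [map_smul, show P (P y) = P y from congr($(hP.mul_self) y)]
  · rw [norm_smul, Complex.norm_real, norm_inv, norm_norm, inv_mul_cancel₀ (norm_ne_zero_iff.2 hy)]

theorem IsMinimalProjector.selfAdjoint_eq_smul (hP : A.IsMinimalProjector P) (hS : S ∈ A)
    (hs : IsSelfAdjoint S) (hPS : P * S = S) : ∃ c : ℝ, S = (c : ℂ) • P := by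
  obtain ⟨x, hPx, hx⟩ := hP.1.exists_unit hP.2.1
  -- Every `S - r • P` is positive or negative, and its value at `x` tells which; this leaves `c` as
  -- the only candidate for the scalar.
  set c : ℝ := S.reApplyInnerSelf x
  have hval (r : ℝ) (y : H) : (S - (r : ℂ) • P).reApplyInnerSelf y =
      S.reApplyInnerSelf y - r * P.reApplyInnerSelf y := by
    rw [ContinuousLinearMap.reApplyInnerSelf_apply, _root_.sub_apply, _root_.smul_apply,
      inner_sub_left, inner_smul_left, Complex.conj_ofReal, map_sub, RCLike.re_to_complex,
      RCLike.re_to_complex, Complex.re_ofReal_mul]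
    rfl
  have hPx1 : P.reApplyInnerSelf x = 1 := by
    rw [ContinuousLinearMap.reApplyInnerSelf_apply, hPx, inner_self_eq_norm_sq, hx, one_pow]
  have hsa (r : ℝ) : IsSelfAdjoint (S - (r : ℂ) • P) := by
    refine hs.sub (IsSelfAdjoint.smul ?_ hP.1.2.isSelfAdjoint)
    simp [isSelfAdjoint_iff]
  have hsign (r : ℝ) : (∀ y, r * P.reApplyInnerSelf y ≤ S.reApplyInnerSelf y) ∨
      (∀ y, S.reApplyInnerSelf y ≤ r * P.reApplyInnerSelf y) := by
    rcases hP.nonneg_or_nonpos (sub_mem hS (smul_mem _ hP.1.1)) (hsa r)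
      (by rw [mul_sub, hPS, mul_smul_comm, hP.1.mul_self]) with h | h
    · left
      intro y
      have := ((ContinuousLinearMap.nonneg_iff_isPositive _).1 h).2 y
      rw [hval] at this
      linarith
    · right
      intro y
      have := ((ContinuousLinearMap.nonneg_iff_isPositive _).1 (neg_nonneg.2 h)).2 y
      have hn : (-(S - (r : ℂ) • P)).reApplyInnerSelf y =
          -(S - (r : ℂ) • P).reApplyInnerSelf y := by
        rw [ContinuousLinearMap.reApplyInnerSelf_apply, _root_.neg_apply, inner_neg_left, map_neg,
          ContinuousLinearMap.reApplyInnerSelf_apply]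
      rw [hn, hval] at this
      linarith
  have hle (y : H) : S.reApplyInnerSelf y = c * P.reApplyInnerSelf y := by
    have hcont : Filter.Tendsto (fun r : ℝ => r * P.reApplyInnerSelf y) (nhds c)
        (nhds (c * P.reApplyInnerSelf y)) := (continuous_mul_const _).tendsto c
    apply le_antisymm
    · refine ge_of_tendsto (hcont.mono_left (nhdsWithin_le_nhds (s := Set.Ioi c)))
        (Filter.eventually_of_mem self_mem_nhdsWithin fun r hr => ?_)
      rcases hsign r with h | h
      · have := h x
        rw [hPx1, mul_one] at this
        exact absurd this (not_le.2 hr)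
      · exact h y
    · refine le_of_tendsto (hcont.mono_left (nhdsWithin_le_nhds (s := Set.Iio c)))
        (Filter.eventually_of_mem self_mem_nhdsWithin fun r hr => ?_)
      rcases hsign r with h | h
      · exact h y
      · have := h x
        rw [hPx1, mul_one] at this
        exact absurd this (not_le.2 hr)
  refine ⟨c, sub_eq_zero.1 ?_⟩
  have hsym := (ContinuousLinearMap.isSelfAdjoint_iff_isSymmetric.1 (hsa c))
  have : (S - (c : ℂ) • P).toLinearMap = 0 := by
    refine inner_map_self_eq_zero _ |>.1 fun y => ?_
    rw [← hsym.coe_re_inner_apply_self]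
    have := hval c y
    rw [hle, sub_self, ContinuousLinearMap.reApplyInnerSelf_apply] at this
    exact (RCLike.ofReal_eq_zero).2 this
  ext y
  exact congr($this y)

/-- The corner of a minimal projector `P` consists of the scalar multiples of `P`. -/
theorem IsMinimalProjector.exists_eq_smul (hP : A.IsMinimalProjector P) (hX : X ∈ A)
    (hPX : P * X = X) (hXP : X * P = X) : ∃ c : ℂ, X = c • P := by
  have hPX' : P * star X = star X := by
    simpa [hP.1.star_eq] using congr(star $hXP)
  obtain ⟨a, ha⟩ := hP.selfAdjoint_eq_smul (add_mem hX (star_mem hX))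
    (IsSelfAdjoint.add_star_self X) (by rw [mul_add, hPX, hPX'])
  obtain ⟨b, hb⟩ := hP.selfAdjoint_eq_smul (smul_mem Complex.I (sub_mem hX (star_mem hX)))
    (by simp [isSelfAdjoint_iff, neg_smul, sub_eq_add_neg, add_comm])
    (by rw [mul_smul_comm, mul_sub, hPX, hPX'])
  -- `X = ((X + X*) - i (i (X - X*))) / 2` splits `X` into self-adjoint parts.
  refine ⟨(a - Complex.I * b) / 2, ?_⟩
  have : X = (1 / 2 : ℂ) • ((X + star X) - Complex.I • (Complex.I • (X - star X))) := by
    rw [smul_smul, Complex.I_mul_I, neg_smul, one_smul]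
    module
  rw [this, ha, hb]
  module

/-! ### Comparison of projectors in a factor -/

/-- In a factor no two nonzero projectors are centrally disjoint: the closed span of `A P H` reduces
both `A` and its commutant, so it is everything. -/
theorem IsFactor.exists_mul_mul_ne_zero (hA : A.IsFactor) (hP : A.IsProjector P) (hP0 : P ≠ 0)
    (hQ0 : Q ≠ 0) : ∃ T ∈ A, Q * T * P ≠ 0 := by
  by_contra! h
  set L : Submodule ℂ H := ⨆ T : A, ((T : H →L[ℂ] H) * P).range
  have hmem (T : H →L[ℂ] H) (hT : T ∈ A) (x : H) : T (P x) ∈ L :=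
    le_iSup (fun T : A => ((T : H →L[ℂ] H) * P).range) ⟨T, hT⟩ ⟨x, rfl⟩
  have hinv (B : H →L[ℂ] H) (hB : ∀ T ∈ A, ∀ x, B (T (P x)) ∈ L) : ∀ x ∈ L, B x ∈ L := by
    have : L ≤ L.comap B.toLinearMap := by
      refine iSup_le ?_
      rintro ⟨T, hT⟩ _ ⟨x, rfl⟩
      exact hB T hT x
    exact this
  set K := L.topologicalClosure
  have hE : A.IsProjector K.starProjection := by
    refine isProjector_starProjection K fun B hB => fun _ hx =>
      map_mem_closure B.continuous hx (hinv B ?_)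
    intro T hT x
    rw [← commutant_commute hB hT, ← commutant_commute hB hP.1]
    exact hmem T hT _
  have hE' : A.commutant.IsProjector K.starProjection := by
    refine isProjector_starProjection K fun B hB => fun _ hx =>
      map_mem_closure B.continuous hx (hinv B ?_)
    rw [commutant_commutant] at hB
    intro T hT x
    exact hmem (B * T) (mul_mem hB hT) x
  obtain ⟨c, hc⟩ := hA _ hE.1 hE'.1
  have hEP (x : H) : K.starProjection (P x) = P x :=
    Submodule.starProjection_eq_self_iff.2 (L.le_topologicalClosure (hmem 1 (one_mem A) x))
  have hc1 : c = 1 := by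
    obtain ⟨x, hPx, hx⟩ := hP.exists_unit hP0
    have := hEP x
    rw [hc, hPx] at this
    have hx0 : x ≠ 0 := by
      rintro rfl
      simp at hx
    exact smul_left_injective ℂ hx0 (by simpa using this)
  have hQK : K ≤ Q.ker := by
    refine Submodule.topologicalClosure_minimal _ (iSup_le ?_) Q.isClosed_ker
    rintro ⟨T, hT⟩ _ ⟨x, rfl⟩
    exact congr($(h T hT) x)
  apply hQ0
  ext x
  have := hQK (Submodule.starProjection_apply_mem K x)
  rw [hc, hc1] at this
  simpa using this

theorem ImplementsEquiv.mul_left (h : A.ImplementsEquiv V P Q) (hP : A.IsProjector P) :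
    V * P = V := by
  have h0 : star (V * (1 - P)) * (V * (1 - P)) = 0 := by
    have : star (V * (1 - P)) * (V * (1 - P)) = star (1 - P) * (star V * V) * (1 - P) := by
      simp only [star_mul, mul_assoc]
    rw [this, h.2.1, mul_assoc, mul_sub, mul_one, hP.mul_self, sub_self, mul_zero]
  have := CStarRing.star_mul_self_eq_zero_iff _ |>.1 h0
  rw [mul_sub, mul_one, sub_eq_zero] at this
  exact this.symm

theorem ImplementsEquiv.symm (h : A.ImplementsEquiv V P Q) : A.ImplementsEquiv (star V) Q P :=
  ⟨star_mem h.1, by rw [star_star, h.2.2], by rw [star_star, h.2.1]⟩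

theorem ImplementsEquiv.mul_right (h : A.ImplementsEquiv V P Q) (hQ : A.IsProjector Q) :
    Q * V = V := by
  simpa [hQ.star_eq] using congr(star $(h.symm.mul_left hQ))

/-- Nonzero elements of `A P` are multiples of partial isometries with initial projector `P`. -/
theorem IsMinimalProjector.exists_partialIsometry (hP : A.IsMinimalProjector P) (hX : X ∈ A)
    (hXP : X * P = X) (hX0 : X ≠ 0) :
    ∃ c : ℂ, A.IsProjector ((c • X) * star (c • X)) ∧ star (c • X) * (c • X) = P := by
  obtain ⟨r, hr⟩ := hP.selfAdjoint_eq_smul (mul_mem (star_mem hX) hX)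
    (IsSelfAdjoint.star_mul_self X) (by
      have : P * star X = star X := by simpa [hP.1.star_eq] using congr(star $hXP)
      rw [← mul_assoc, this])
  have hr0 : 0 < r := by
    obtain ⟨x, hPx, hx⟩ := hP.1.exists_unit hP.2.1
    have hval : ‖X x‖ ^ 2 = r := by
      have h1 : inner ℂ ((star X * X) x) x = ((‖X x‖ ^ 2 : ℝ) : ℂ) := by
        rw [ContinuousLinearMap.star_eq_adjoint, mul_apply_eq_comp,
          ContinuousLinearMap.adjoint_inner_left, inner_self_eq_norm_sq_to_K]
        simp
      rw [hr, _root_.smul_apply, hPx, inner_smul_left, inner_self_eq_norm_sq_to_K,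
        hx] at h1
      simp only [Complex.conj_ofReal, RCLike.ofReal_one, one_pow, mul_one] at h1
      exact_mod_cast h1.symm
    have hne : r ≠ 0 := by
      rintro rfl
      simp only [Complex.ofReal_zero, zero_smul] at hr
      exact hX0 ((CStarRing.star_mul_self_eq_zero_iff _).1 hr)
    exact lt_of_le_of_ne (hval ▸ sq_nonneg _) hne.symm
  obtain ⟨c, hcc⟩ : ∃ c : ℂ, star c * c * r = 1 := by
    refine ⟨((Real.sqrt r)⁻¹ : ℝ), ?_⟩
    rw [Complex.star_def, Complex.conj_ofReal, ← Complex.ofReal_mul, ← Complex.ofReal_mul,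
      ← mul_inv, Real.mul_self_sqrt hr0.le, inv_mul_cancel₀ hr0.ne', Complex.ofReal_one]
  have hV : star (c • X) * (c • X) = P := by
    rw [star_smul, smul_mul_smul_comm, hr, smul_smul, hcc, one_smul]
  have hVP : (c • X) * P = c • X := by rw [smul_mul_assoc, hXP]
  refine ⟨c, ⟨mul_mem (smul_mem _ hX) (star_mem (smul_mem _ hX)), ?_, ?_⟩, hV⟩
  · change _ * _ = _
    rw [mul_assoc, ← mul_assoc (star _), hV, ← mul_assoc, hVP]
  · exact IsSelfAdjoint.mul_star_self _

/-- Projectors below `Q` correspond to projectors below `P` via `E ↦ V E V*`, so minimality passes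
to equivalent projectors. -/
theorem ImplementsEquiv.isMinimalProjector (h : A.ImplementsEquiv V Q P) (hQ : A.IsProjector Q)
    (hP : A.IsMinimalProjector P) : A.IsMinimalProjector Q := by
  refine ⟨hQ, ?_, fun E hE hE0 hlt => ?_⟩
  · rintro rfl
    have hV := (CStarRing.star_mul_self_eq_zero_iff _).1 h.2.1
    apply hP.2.1
    rw [← h.2.2, hV, zero_mul]
  have hQE : Q * E = E := (hE.2.le_iff_mul_eq_right hQ.2).1 hlt.le
  have hEQ : E * Q = E := (hE.2.le_iff_mul_eq_left hQ.2).1 hlt.le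
  have hback : star V * (V * E * star V) * V = E := by
    calc star V * (V * E * star V) * V = (star V * V) * E * (star V * V) := by
          simp only [mul_assoc]
      _ = E := by rw [h.2.1, hQE, hEQ]
  have hproj : A.IsProjector (V * E * star V) := by
    refine ⟨mul_mem (mul_mem h.1 hE.1) (star_mem h.1), ?_, ?_⟩
    · change _ * _ = _
      calc V * E * star V * (V * E * star V) = V * (E * (star V * V) * E) * star V := by
            simp only [mul_assoc]
        _ = V * E * star V := by rw [h.2.1, hEQ, hE.mul_self]
    · simp [isSelfAdjoint_iff, hE.star_eq, mul_assoc]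
  have := hP.eq_of_mul_eq hproj (fun h0 => hE0 (by rw [← hback, h0, mul_zero, zero_mul]))
    (by rw [← mul_assoc, ← mul_assoc, h.mul_right hP.1])
  rw [this, mul_assoc, h.mul_right hP.1, h.2.1] at hback
  exact hlt.ne hback.symm

/-- Below every nonzero projector of a factor there is a copy of a given minimal projector. -/
theorem IsFactor.exists_equiv_le (hA : A.IsFactor) (hP : A.IsMinimalProjector P)
    (hR : A.IsProjector R) (hR0 : R ≠ 0) :
    ∃ V Q, A.IsProjector Q ∧ R * Q = Q ∧ A.ImplementsEquiv V Q P := by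
  obtain ⟨T, hT, hne⟩ := hA.exists_mul_mul_ne_zero hP.1 hP.2.1 hR0
  have hX : R * T * P ∈ A := mul_mem (mul_mem hR.1 hT) hP.1.1
  obtain ⟨c, hQ, hV⟩ := hP.exists_partialIsometry hX (by rw [mul_assoc, hP.1.mul_self]) hne
  refine ⟨star (c • (R * T * P)), _, hQ, ?_, star_mem (smul_mem _ hX), by rw [star_star],
    by rw [star_star, hV]⟩
  rw [← mul_assoc, mul_smul_comm, ← mul_assoc, ← mul_assoc, hR.mul_self]

/-- In a factor, the copies of a minimal projector are exactly the minimal projectors. -/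
theorem IsFactor.isMinimalProjector_iff (hA : A.IsFactor) (hP : A.IsMinimalProjector P) :
    A.IsMinimalProjector Q ↔ A.IsProjector Q ∧ A.ProjectorEquiv Q P := by
  refine ⟨fun hQ => ⟨hQ.1, ?_⟩, fun ⟨hQ, V, hV⟩ => hV.isMinimalProjector hQ hP⟩
  obtain ⟨V, E, hE, hQE, hV⟩ := hA.exists_equiv_le hP hQ.1 hQ.2.1
  have hEQ := hQ.eq_of_mul_eq hE (hV.isMinimalProjector hE hP).2.1 hQE
  exact ⟨V, hEQ ▸ hV⟩

theorem IsFactor.isOrthogonalCopies_eq (hA : A.IsFactor) (hP : A.IsMinimalProjector P) :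
    A.IsOrthogonalCopies P = A.IsOrthogonalMinimalSet := by
  funext F
  simp only [IsOrthogonalCopies, IsOrthogonalMinimalSet, hA.isMinimalProjector_iff hP]

end VonNeumannAlgebra

namespace VonNeumannAlgebra

variable {H : Type*} [NormedAddCommGroup H] [InnerProductSpace ℂ H] [CompleteSpace H]
  {A : VonNeumannAlgebra H} {P Q R V W S T X Y : H →L[ℂ] H} {F G : Set (H →L[ℂ] H)}

/-! ### Maximal families of minimal projectors -/

theorem exists_maximal_isOrthogonalMinimalSet (A : VonNeumannAlgebra H) :
    ∃ F, Maximal A.IsOrthogonalMinimalSet F := by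
  refine zorn_subset {F | A.IsOrthogonalMinimalSet F} fun c hc hchain => ⟨⋃₀ c, ⟨?_, ?_⟩,
    fun s hs => Set.subset_sUnion_of_mem hs⟩
  · rintro Q ⟨s, hs, hQ⟩
    exact (hc hs).1 Q hQ
  · exact (Set.pairwise_sUnion hchain.directedOn).2 fun s hs => (hc hs).2

theorem IsProjector.apply_mem_range (hP : A.IsProjector P) {x : H} (hx : x ∈ P.range) :
    P x = x := by
  obtain ⟨y, rfl⟩ := hx
  exact congr($(hP.mul_self) y)

theorem IsProjector.inner_apply_left (hP : A.IsProjector P) (x y : H) :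
    ⟪P x, y⟫_ℂ = ⟪x, P y⟫_ℂ := by
  conv_lhs => rw [← hP.star_eq]
  exact P.adjoint_inner_left y x

/-- The ranges of a maximal orthogonal family of minimal projectors span a dense subspace: otherwise
the projector on the orthogonal complement dominates a further minimal projector. -/
theorem IsFactor.iSup_range_dense (hA : A.IsFactor) (hP : A.IsMinimalProjector P)
    (hF : Maximal A.IsOrthogonalMinimalSet F) :
    (⨆ Q : F, (Q : H →L[ℂ] H).range).topologicalClosure = ⊤ := by
  set L : Submodule ℂ H := ⨆ Q : F, (Q : H →L[ℂ] H).range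
  set K := L.topologicalClosure
  have hmem (Q : H →L[ℂ] H) (hQ : Q ∈ F) (x : H) : Q x ∈ K :=
    L.le_topologicalClosure (le_iSup (fun Q : F => (Q : H →L[ℂ] H).range) ⟨Q, hQ⟩ ⟨x, rfl⟩)
  have hE : A.IsProjector K.starProjection := by
    refine isProjector_starProjection K fun B hB _ hx => map_mem_closure B.continuous hx ?_
    have : L ≤ L.comap B.toLinearMap := by
      refine iSup_le ?_
      rintro ⟨Q, hQ⟩ _ ⟨x, rfl⟩
      change B (Q x) ∈ L
      rw [← commutant_commute hB (hF.prop.1 Q hQ).1.1]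
      exact le_iSup (fun Q : F => (Q : H →L[ℂ] H).range) ⟨Q, hQ⟩ ⟨B x, rfl⟩
    exact this
  have hR : A.IsProjector (1 - K.starProjection) := ⟨sub_mem (one_mem A) hE.1, hE.2.one_sub⟩
  suffices h : 1 - K.starProjection = 0 by
    rw [eq_top_iff]
    intro x _
    have hx : x - K.starProjection x = 0 := congr($h x)
    rw [sub_eq_zero] at hx
    rw [hx]
    exact Submodule.starProjection_apply_mem K x
  by_contra hR0
  obtain ⟨V, Q, hQ, hRQ, hV⟩ := hA.exists_equiv_le hP hR hR0
  have hQmin := hV.isMinimalProjector hQ hP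
  have hRS (S : H →L[ℂ] H) (hS : S ∈ F) : (1 - K.starProjection) * S = 0 := by
    have : K.starProjection * S = S := by
      ext x
      exact Submodule.starProjection_eq_self_iff.2 (hmem S hS x)
    rw [sub_mul, one_mul, this, sub_self]
  have hQR : Q * (1 - K.starProjection) = Q := by
    simpa [hQ.star_eq, hR.star_eq, -star_sub] using congr(star $hRQ)
  have hQS (S : H →L[ℂ] H) (hS : S ∈ F) : Q * S = 0 := by
    rw [← hQR, mul_assoc, hRS S hS, mul_zero]
  have hSQ (S : H →L[ℂ] H) (hS : S ∈ F) : S * Q = 0 := by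
    simpa [hQ.star_eq, (hF.prop.1 S hS).1.star_eq] using congr(star $(hQS S hS))
  have hins : A.IsOrthogonalMinimalSet (insert Q F) := by
    refine ⟨?_, ?_⟩
    · rintro S (rfl | hS)
      · exact hQmin
      · exact hF.prop.1 S hS
    · exact hF.prop.2.insert fun S hS _ => ⟨hQS S hS, hSQ S hS⟩
  have hQF : Q ∈ F := hF.le_of_ge hins (Set.subset_insert Q F) (Set.mem_insert Q F)
  apply hQmin.2.1
  rw [← hQ.mul_self, hQS Q hQF]

theorem IsFactor.hasSum_apply (hA : A.IsFactor) (hP : A.IsMinimalProjector P)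
    (hF : Maximal A.IsOrthogonalMinimalSet F) (x : H) :
    HasSum (fun Q : F => (Q : H →L[ℂ] H) x) x := by
  have hproj (Q : F) : A.IsProjector Q := (hF.prop.1 Q Q.2).1
  have hcomp (Q : F) : CompleteSpace (Q : H →L[ℂ] H).range :=
    (ContinuousLinearMap.IsIdempotentElem.isClosed_range
      (hproj Q).2.isIdempotentElem).completeSpace_coe
  have hsum : IsHilbertSum ℂ (fun Q : F => (Q : H →L[ℂ] H).range)
      fun Q => (Q : H →L[ℂ] H).range.subtypeₗᵢ := by
    refine IsHilbertSum.mkInternal _ ?_ (hA.iSup_range_dense hP hF).ge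
    rintro Q R hQR ⟨_, ⟨y, rfl⟩⟩ ⟨_, ⟨z, rfl⟩⟩
    change ⟪(Q : H →L[ℂ] H) y, (R : H →L[ℂ] H) z⟫_ℂ = 0
    have h0 : (Q : H →L[ℂ] H) ((R : H →L[ℂ] H) z) = 0 :=
      congr($(hF.prop.2 Q.2 R.2 (Subtype.coe_injective.ne hQR)) z)
    rw [(hproj Q).inner_apply_left, h0, inner_zero_right]
  obtain ⟨w, rfl⟩ := hsum.linearIsometryEquiv.symm.surjective x
  have hw := hsum.hasSum_linearIsometryEquiv_symm w
  convert hw using 1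
  funext Q
  have hQ := hw.mapL (Q : H →L[ℂ] H)
  have hQ' := hasSum_single (f := fun R : F => (Q : H →L[ℂ] H)
    ((R : H →L[ℂ] H).range.subtypeₗᵢ (w R))) Q (by
      intro R hRQ
      have hR := (hproj R).apply_mem_range (w R).2
      change (Q : H →L[ℂ] H) (w R : H) = 0
      rw [← hR]
      exact congr($(hF.prop.2 Q.2 R.2 (Subtype.coe_injective.ne hRQ.symm)) _))
  rw [hQ.unique hQ']
  exact (hproj Q).apply_mem_range (w Q).2

/-- Unit vectors in the ranges of the projectors have mutual distance `√2`, so separability leaves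
room for only countably many. -/
theorem IsOrthogonalMinimalSet.countable [TopologicalSpace.SeparableSpace H]
    (hF : A.IsOrthogonalMinimalSet F) : F.Countable := by
  choose x hQx hx using fun Q : F => (hF.1 Q Q.2).1.exists_unit (hF.1 Q Q.2).2.1
  refine Set.countable_coe_iff.1 (Pairwise.countable_of_isOpen_disjoint
    (s := fun Q : F => Metric.ball (x Q) (1 / 2)) (fun Q R hQR => ?_) (fun _ => Metric.isOpen_ball)
    fun Q => ⟨x Q, Metric.mem_ball_self (by norm_num)⟩)
  refine Metric.ball_disjoint_ball ?_
  have h0 : ⟪x Q, x R⟫_ℂ = 0 := by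
    have h : (Q : H →L[ℂ] H) (x R) = 0 := by
      rw [← hQx R]
      exact congr($(hF.2 Q.2 R.2 (Subtype.coe_injective.ne hQR)) _)
    rw [← hQx Q, (hF.1 Q Q.2).1.inner_apply_left, h, inner_zero_right]
  have h2 : ‖x Q - x R‖ ^ 2 = 2 := by
    rw [@norm_sub_sq ℂ, h0, hx, hx]
    norm_num
  rw [dist_eq_norm]
  nlinarith [norm_nonneg (x Q - x R)]

/-! ### Matrix units -/

theorem ImplementsEquiv.apply_star_apply (hV : A.ImplementsEquiv V Q P) (x : H) :
    V (star V x) = P x :=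
  congr($(hV.2.2) x)

theorem inner_star_apply_left (V : H →L[ℂ] H) (x y : H) : ⟪star V x, y⟫_ℂ = ⟪x, V y⟫_ℂ :=
  V.adjoint_inner_left y x

/-- Partial isometries with orthogonal initial projectors have orthogonal initial spaces. -/
theorem ImplementsEquiv.mul_star_eq_zero (hV : A.ImplementsEquiv V Q P)
    (hW : A.ImplementsEquiv W R P) (hQ : A.IsProjector Q) (hR : A.IsProjector R)
    (hQR : Q * R = 0) : V * star W = 0 := by
  rw [← hV.mul_left hQ, ← hW.symm.mul_right hR, mul_assoc, ← mul_assoc Q, hQR, zero_mul, mul_zero]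

/-- The entries of `T ∈ A` with respect to a system of matrix units are scalar. -/
theorem ImplementsEquiv.exists_mul_mul_eq_smul (hV : A.ImplementsEquiv V Q P)
    (hW : A.ImplementsEquiv W R P) (hP : A.IsMinimalProjector P) (hT : T ∈ A) :
    ∃ c : ℂ, V * T * star W = c • P := by
  refine hP.exists_eq_smul (mul_mem (mul_mem hV.1 hT) (star_mem hW.1)) ?_ ?_
  · rw [← mul_assoc, ← mul_assoc, hV.mul_right hP.1]
  · rw [mul_assoc, hW.symm.mul_left hP.1]

/-- A system of matrix units for the family `F` of projectors: partial isometries `V Q ∈ A` from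
`Q ∈ F` onto a fixed projector `P`, where `A` is a factor, `P` is minimal and `F` is a maximal
orthogonal family of minimal projectors. -/
structure IsMatrixUnits (A : VonNeumannAlgebra H) (P : H →L[ℂ] H) (F : Set (H →L[ℂ] H))
    (V : F → (H →L[ℂ] H)) : Prop where
  isFactor : A.IsFactor
  isMinimal : A.IsMinimalProjector P
  maximal : Maximal A.IsOrthogonalMinimalSet F
  implementsEquiv : ∀ Q : F, A.ImplementsEquiv (V Q) Q P

theorem IsFactor.exists_isMatrixUnits (hA : A.IsFactor) (hP : A.IsMinimalProjector P)
    (hF : Maximal A.IsOrthogonalMinimalSet F) : ∃ V, A.IsMatrixUnits P F V := by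
  choose V hV using fun Q : F => ((hA.isMinimalProjector_iff hP).1 (hF.prop.1 Q Q.2)).2
  exact ⟨V, hA, hP, hF, hV⟩

namespace IsMatrixUnits

variable {V : F → (H →L[ℂ] H)} (h : A.IsMatrixUnits P F V)
include h

theorem isProjector (Q : F) : A.IsProjector Q := (h.maximal.prop.1 Q Q.2).1

theorem mul_star_eq_zero {Q R : F} (hQR : Q ≠ R) : V Q * star (V R) = 0 :=
  (h.implementsEquiv Q).mul_star_eq_zero (h.implementsEquiv R) (h.isProjector Q) (h.isProjector R)
    (h.maximal.prop.2 Q.2 R.2 (Subtype.coe_injective.ne hQR))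

theorem inner_star_apply (Q : F) {x y : H} (hy : P y = y) :
    ⟪star (V Q) x, star (V Q) y⟫_ℂ = ⟪x, y⟫_ℂ := by
  rw [inner_star_apply_left, (h.implementsEquiv Q).apply_star_apply, hy]

theorem inner_star_apply_of_ne {Q R : F} (hQR : Q ≠ R) (x y : H) :
    ⟪star (V Q) x, star (V R) y⟫_ℂ = 0 := by
  have h0 : V Q (star (V R) y) = 0 := congr($(h.mul_star_eq_zero hQR) y)
  rw [inner_star_apply_left, h0, inner_zero_right]

theorem orthonormal {x : H} (hPx : P x = x) (hx : ‖x‖ = 1) :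
    Orthonormal ℂ fun Q : F => star (V Q) x := by
  classical
  rw [orthonormal_iff_ite]
  intro Q R
  split_ifs with hQR
  · rw [← hQR, h.inner_star_apply Q hPx, inner_self_eq_norm_sq_to_K, hx]
    simp
  · exact h.inner_star_apply_of_ne hQR x x

/-- For finite `F`, expand `T x = ∑ Q T x` and use `Q T x = V_Q^* (V_Q T P) x`, where `V_Q T P` is
a multiple of `P`. -/
theorem apply_mem_span [Finite F] (hT : T ∈ A) {x : H} (hPx : P x = x) :
    T x ∈ Submodule.span ℂ (Set.range fun Q : F => star (V Q) x) := by
  have := Fintype.ofFinite F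
  have hsum := h.isFactor.hasSum_apply h.isMinimal h.maximal (T x)
  rw [(hasSum_fintype _).unique hsum |>.symm]
  refine sum_mem fun Q _ => ?_
  obtain ⟨c, hc⟩ := (h.implementsEquiv Q).exists_mul_mul_eq_smul (W := P) (R := P)
    ⟨h.isMinimal.1.1, by rw [h.isMinimal.1.star_eq, h.isMinimal.1.mul_self],
      by rw [h.isMinimal.1.star_eq, h.isMinimal.1.mul_self]⟩ h.isMinimal hT
  rw [h.isMinimal.1.star_eq] at hc
  have hQ : (Q : H →L[ℂ] H) (T x) = c • star (V Q) x := by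
    have h1 : V Q (T (P x)) = c • P x := congr($hc x)
    rw [← (h.implementsEquiv Q).2.1, mul_apply_eq_comp]
    rw [hPx] at h1
    rw [h1, map_smul]
  rw [hQ]
  exact Submodule.smul_mem _ _ (Submodule.subset_span ⟨Q, rfl⟩)

/-- A maximal family of minimal projectors is no larger than any other. For a unit vector `x ∈ P H`,
the vectors `V_Q^* x` form an orthonormal basis of the closure of `A x`; if `F` is
finite, the vectors `W_R^* x` are linearly independent elements of their finite-dimensional span. -/
theorem encard_le {W : G → (H →L[ℂ] H)} (hG : A.IsMatrixUnits P G W) : G.encard ≤ F.encard := by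
  rcases F.finite_or_infinite with hF | hF
  · have := hF.to_subtype
    have := Fintype.ofFinite F
    classical
    obtain ⟨x, hPx, hx⟩ := h.isMinimal.1.exists_unit h.isMinimal.2.1
    have hle := linearIndependent_le_span' _ (hG.orthonormal hPx hx).linearIndependent
      (Set.range fun Q : F => star (V Q) x) (by
        rintro _ ⟨R, rfl⟩
        exact h.apply_mem_span (star_mem (hG.implementsEquiv R).1) hPx)
    have hle' : Cardinal.mk G ≤ (Fintype.card F : Cardinal) :=
      hle.trans (Nat.cast_le.2 (Fintype.card_range_le _))
    have := Cardinal.toENat.monotone' hle'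
    rw [← Cardinal.mk_fintype] at this
    exact this
  · rw [hF.encard_eq]
    exact le_top

end IsMatrixUnits

theorem IsFactor.encard_eq (hA : A.IsFactor) (hP : A.IsMinimalProjector P)
    (hF : Maximal A.IsOrthogonalMinimalSet F) (hG : Maximal A.IsOrthogonalMinimalSet G) :
    F.encard = G.encard := by
  obtain ⟨V, hV⟩ := hA.exists_isMatrixUnits hP hF
  obtain ⟨W, hW⟩ := hA.exists_isMatrixUnits hP hG
  exact (hW.encard_le hV).antisymm (hV.encard_le hW)

end VonNeumannAlgebra

/-! ### Hilbert space tensor products with `ℓ²(F)` -/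

/-- The vectors `e_j` are total in `ℓ²(F)`. -/
theorem labelSpace_eq_top_of_isClosed {α : Type*} {F : Set α} {K : Submodule ℂ (LabelSpace F)}
    (hK : IsClosed (K : Set (LabelSpace F))) (h : ∀ j, labelVector j ∈ K) : K = ⊤ := by
  classical
  rw [eq_top_iff]
  intro f _
  refine hK.mem_of_tendsto (lp.hasSum_single (by simp) f) (Filter.Eventually.of_forall fun s => ?_)
  refine sum_mem fun j _ => ?_
  have hj : lp.single (E := fun _ : F => ℂ) 2 j (f j) = f j • labelVector j := by
    rw [labelVector, ← lp.single_smul, smul_eq_mul, mul_one]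
  rw [hj]
  exact K.smul_mem _ (h j)

theorem orthonormal_labelVector {α : Type*} (F : Set α) :
    Orthonormal ℂ (labelVector : F → LabelSpace F) := by
  classical
  rw [orthonormal_iff_ite]
  intro i j
  rw [labelVector, lp.inner_single_left, labelVector, lp.single_apply, Pi.single_apply]
  split_ifs <;> simp_all

namespace HilbertTensor

variable {E F : Type*} [NormedAddCommGroup E] [InnerProductSpace ℂ E]
  [NormedAddCommGroup F] [InnerProductSpace ℂ F]

theorem inner_tmul (a b : E) (x y : F) : ⟪tmul a x, tmul b y⟫_ℂ = ⟪a, b⟫_ℂ * ⟪x, y⟫_ℂ := by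
  rw [tmul, tmul, UniformSpace.Completion.inner_coe, TensorProduct.inner_tmul]

/-- The bounded operator `a ↦ a ⊗ x`. -/
noncomputable def tmulRight (x : F) : E →L[ℂ] Space E F :=
  UniformSpace.Completion.toComplL.comp ((TensorProduct.mkL ℂ E F).flip x)

@[simp]
theorem tmulRight_apply (x : F) (a : E) : tmulRight x a = tmul a x := rfl

/-- The isometry `x ↦ e ⊗ x` defined by a unit vector `e`. -/
noncomputable def tmulLeft (e : E) (he : ‖e‖ = 1) : F →ₗᵢ[ℂ] Space E F where
  toLinearMap := (UniformSpace.Completion.toComplL.comp (TensorProduct.mkL ℂ E F e)).toLinearMap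
  norm_map' x := by
    change ‖((e ⊗ₜ[ℂ] x : E ⊗[ℂ] F) : Space E F)‖ = ‖x‖
    rw [UniformSpace.Completion.norm_coe, TensorProduct.norm_tmul, he, one_mul]

@[simp]
theorem tmulLeft_apply (e : E) (he : ‖e‖ = 1) (x : F) : tmulLeft e he x = tmul e x := rfl

theorem eq_top_of_isClosed {K : Submodule ℂ (Space E F)} (hK : IsClosed (K : Set (Space E F)))
    (h : ∀ a x, tmul a x ∈ K) : K = ⊤ := by
  rw [Submodule.eq_top_iff']
  intro z
  induction z using UniformSpace.Completion.induction_on with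
  | hp => exact hK
  | ih z =>
    induction z using TensorProduct.induction_on with
    | zero => exact K.zero_mem
    | tmul a x => exact h a x
    | add u v hu hv =>
      rw [UniformSpace.Completion.coe_add]
      exact K.add_mem hu hv

/-- The vectors `e_j ⊗ x` are total in `ℓ²(J) ⊗ F`. -/
theorem eq_top_of_labelVector {α : Type*} {J : Set α} {K : Submodule ℂ (Space (LabelSpace J) F)}
    (hK : IsClosed (K : Set (Space (LabelSpace J) F)))
    (h : ∀ j x, tmul (labelVector j) x ∈ K) : K = ⊤ := by
  refine eq_top_of_isClosed hK fun a x => ?_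
  have : K.comap (tmulRight (E := LabelSpace J) x).toLinearMap = ⊤ :=
    labelSpace_eq_top_of_isClosed (hK.preimage (tmulRight x).continuous) fun j => h j x
  exact this.ge (Submodule.mem_top (x := a))

theorem ext_labelVector {α : Type*} {J : Set α} {M : Type*} [NormedAddCommGroup M]
    [NormedSpace ℂ M] {S T : Space (LabelSpace J) F →L[ℂ] M}
    (h : ∀ j x, S (tmul (labelVector j) x) = T (tmul (labelVector j) x)) : S = T := by
  have : LinearMap.eqLocus S.toLinearMap T.toLinearMap = ⊤ :=
    eq_top_of_labelVector (isClosed_eq S.continuous T.continuous) h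
  ext z
  exact this.ge (Submodule.mem_top (x := z))

theorem eq_of_forall_inner_labelVector {α : Type*} {J : Set α} {u v : Space (LabelSpace J) F}
    (h : ∀ j x, ⟪tmul (labelVector j) x, u⟫_ℂ = ⟪tmul (labelVector j) x, v⟫_ℂ) : u = v := by
  have : (ℂ ∙ (u - v))ᗮ = ⊤ := by
    refine eq_top_of_labelVector (Submodule.isClosed_orthogonal _) fun j x => ?_
    rw [Submodule.mem_orthogonal_singleton_iff_inner_left, inner_sub_right, h, sub_self]
  have hmem := this.ge (Submodule.mem_top (x := u - v))
  rw [Submodule.mem_orthogonal_singleton_iff_inner_left, inner_self_eq_zero, sub_eq_zero] at hmem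
  exact hmem

/-- An isometric isomorphism with `ℓ²(J) ⊗ F`, given by its inverse on the vectors `e_j ⊗ x`. -/
theorem exists_linearIsometryEquiv {α : Type*} {J : Set α} [CompleteSpace F] {M : Type*}
    [NormedAddCommGroup M] [InnerProductSpace ℂ M] [CompleteSpace M] {v : J → F →ₗᵢ[ℂ] M}
    (hv : IsHilbertSum ℂ (fun _ : J => F) v) :
    ∃ U : M ≃ₗᵢ[ℂ] Space (LabelSpace J) F, ∀ j x, U (v j x) = tmul (labelVector j) x := by
  classical
  have hw : IsHilbertSum ℂ (fun _ : J => F) fun j =>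
      tmulLeft (F := F) (labelVector j) ((orthonormal_labelVector J).1 j) := by
    refine IsHilbertSum.mk (fun i j hij x y => ?_) ?_
    · rw [tmulLeft_apply, tmulLeft_apply, inner_tmul, (orthonormal_labelVector J).2 hij, zero_mul]
    · refine (eq_top_of_labelVector (Submodule.isClosed_topologicalClosure _) fun j x => ?_).ge
      exact Submodule.le_topologicalClosure _ (Submodule.mem_iSup_of_mem j ⟨x, rfl⟩)
  -- Both spaces are the Hilbert sum of copies of `F` labelled by `J`.
  refine ⟨hv.linearIsometryEquiv.trans hw.linearIsometryEquiv.symm, fun j x => ?_⟩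
  rw [LinearIsometryEquiv.trans_apply, ← hv.linearIsometryEquiv_symm_apply_single x,
    LinearIsometryEquiv.apply_symm_apply, hw.linearIsometryEquiv_symm_apply_single x,
    tmulLeft_apply]

end HilbertTensor

/-! ### The spatial isomorphism -/

namespace VonNeumannAlgebra.IsMatrixUnits

open HilbertTensor

variable {H : Type*} [NormedAddCommGroup H] [InnerProductSpace ℂ H] [CompleteSpace H]
  {A : VonNeumannAlgebra H} {P T : H →L[ℂ] H} {F : Set (H →L[ℂ] H)}
  {V : F → (H →L[ℂ] H)} (h : A.IsMatrixUnits P F V)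
include h

/-- The isometry of `P H` onto `Q H` induced by the matrix unit `V_Q^*`. -/
noncomputable def isometry (Q : F) : P.range →ₗᵢ[ℂ] H where
  toLinearMap := (star (V Q)).toLinearMap ∘ₗ P.range.subtype
  norm_map' x := by
    have := h.inner_star_apply Q (x := x) (h.isMinimal.1.apply_mem_range x.2)
    rw [inner_self_eq_norm_sq_to_K, inner_self_eq_norm_sq_to_K] at this
    exact (sq_eq_sq₀ (norm_nonneg _) (norm_nonneg _)).1 (by exact_mod_cast this)

theorem completeSpace_range : CompleteSpace P.range :=
  (ContinuousLinearMap.IsIdempotentElem.isClosed_range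
    h.isMinimal.1.2.isIdempotentElem).completeSpace_coe

/-- The space `H` is the Hilbert sum of the copies `V_Q^* P H` of `P H`. -/
theorem isHilbertSum : IsHilbertSum ℂ (fun _ : F => P.range) h.isometry := by
  have := h.completeSpace_range
  refine IsHilbertSum.mk (fun Q R hQR x y => h.inner_star_apply_of_ne hQR _ _) ?_
  rw [← h.isFactor.iSup_range_dense h.isMinimal h.maximal]
  refine Submodule.topologicalClosure_mono (iSup_mono fun Q => ?_)
  rintro _ ⟨x, rfl⟩
  refine ⟨⟨V Q x, V Q x, ?_⟩, ?_⟩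
  · exact congr($((h.implementsEquiv Q).mul_right h.isMinimal.1) x)
  · exact congr($((h.implementsEquiv Q).2.1) x)

/-- The vectors `V_Q^* x` with `Q ∈ F` and `x ∈ P H` are total. -/
theorem ext {S T : H →L[ℂ] H} (hST : ∀ Q, ∀ x : P.range, S (star (V Q) x) = T (star (V Q) x)) :
    S = T := by
  ext z
  obtain ⟨w, rfl⟩ := h.isHilbertSum.linearIsometryEquiv.symm.surjective z
  have hw := h.isHilbertSum.hasSum_linearIsometryEquiv_symm w
  refine (hw.mapL S).unique ?_
  convert hw.mapL T using 2 with Q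
  exact hST Q _

variable {U : H ≃ₗᵢ[ℂ] Space (LabelSpace F) P.range}
  (hU : ∀ (Q : F) (x : P.range), U (star (V Q) (x : H)) = tmul (labelVector Q) x)
include hU

/-- An operator transported from `A` acts only on the left tensor factor. Its component there is
the compression `j* S j` along `j : a ↦ a ⊗ x`, for any unit vector `x ∈ P H`; the two operators
have the same matrix entries because `V_Q T V_R^*` is a multiple of `P`. -/
theorem exists_ampliation_eq (hT : T ∈ A)
    {S : Space (LabelSpace F) P.range →L[ℂ] Space (LabelSpace F) P.range}
    (hS : ∀ z, S z = U (T (U.symm z))) : ∃ S₀, ampliation P.range S₀ = S := by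
  have := h.completeSpace_range
  obtain ⟨x₀, hPx, hx⟩ := h.isMinimal.1.exists_unit h.isMinimal.2.1
  set x : P.range := ⟨x₀, x₀, hPx⟩
  set j : LabelSpace F →L[ℂ] Space (LabelSpace F) P.range := tmulRight x
  have hentry (Q R : F) (y z : P.range) (c : ℂ) (hc : V Q * T * star (V R) = c • P) :
      ⟪tmul (labelVector Q) z, S (tmul (labelVector R) y)⟫_ℂ = c * ⟪z, y⟫_ℂ := by
    have hy : V Q (T (star (V R) (y : H))) = c • (y : H) := by
      have h1 : V Q (T (star (V R) (y : H))) = c • P (y : H) := congr($hc (y : H))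
      rw [h1, h.isMinimal.1.apply_mem_range y.2]
    rw [hS, ← hU R y, LinearIsometryEquiv.symm_apply_apply, ← hU Q z,
      LinearIsometryEquiv.inner_map_map, inner_star_apply_left, hy, inner_smul_right,
      Submodule.coe_inner]
  refine ⟨(ContinuousLinearMap.adjoint j).comp (S.comp j), ext_labelVector fun R y => ?_⟩
  refine eq_of_forall_inner_labelVector fun Q z => ?_
  obtain ⟨c, hc⟩ := (h.implementsEquiv Q).exists_mul_mul_eq_smul (h.implementsEquiv R)
    h.isMinimal hT
  have hxx : ⟪x, x⟫_ℂ = 1 := by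
    rw [Submodule.coe_inner, inner_self_eq_norm_sq_to_K, hx]
    simp
  rw [ampliation_tmul, inner_tmul, hentry Q R y z c hc]
  change ⟪labelVector Q, ContinuousLinearMap.adjoint j (S (j (labelVector R)))⟫_ℂ * _ = _
  rw [ContinuousLinearMap.adjoint_inner_right, tmulRight_apply, tmulRight_apply,
    hentry Q R x x c hc, hxx, mul_one]

/-- Elements of the commutant of `A` act only on the right tensor factor. -/
theorem commutant_apply_symm_tmul {B : H →L[ℂ] H} (hB : B ∈ A.commutant) (a : LabelSpace F)
    (x y : P.range) (hy : (y : H) = B x) : B (U.symm (tmul a x)) = U.symm (tmul a y) := by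
  have : LinearMap.eqLocus (B.toLinearMap ∘ₗ U.symm.toLinearEquiv.toLinearMap ∘ₗ
      (tmulRight (E := LabelSpace F) x).toLinearMap)
      (U.symm.toLinearEquiv.toLinearMap ∘ₗ (tmulRight (E := LabelSpace F) y).toLinearMap) = ⊤ := by
    refine labelSpace_eq_top_of_isClosed (isClosed_eq
      (B.continuous.comp (U.symm.continuous.comp (tmulRight x).continuous))
      (U.symm.continuous.comp (tmulRight y).continuous)) fun Q => ?_
    change B (U.symm (tmul _ x)) = U.symm (tmul _ y)
    rw [← hU Q x, ← hU Q y, LinearIsometryEquiv.symm_apply_apply,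
      LinearIsometryEquiv.symm_apply_apply, hy,
      commutant_commute hB (star_mem (h.implementsEquiv Q).1)]
  exact this.ge (Submodule.mem_top (x := a))

/-- Operators on the left tensor factor are transported into `A`, because they commute with the
commutant of `A`. -/
theorem exists_mem_of_ampliation (S₀ : LabelSpace F →L[ℂ] LabelSpace F) :
    ∃ T ∈ A, ∀ z, ampliation P.range S₀ z = U (T (U.symm z)) := by
  refine ⟨(U.symm : Space (LabelSpace F) P.range →L[ℂ] H).comp
    ((ampliation P.range S₀).comp (U : H →L[ℂ] Space (LabelSpace F) P.range)),
    mem_of_forall_commutant fun B hB => h.ext fun Q x => ?_, fun z => by simp⟩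
  have hBx : B (x : H) ∈ P.range := by
    refine ⟨B x, ?_⟩
    change P (B x) = B x
    rw [commutant_commute hB h.isMinimal.1.1, h.isMinimal.1.apply_mem_range x.2]
  change B (U.symm (ampliation P.range S₀ (U (star (V Q) x)))) =
    U.symm (ampliation P.range S₀ (U (B (star (V Q) x))))
  rw [← commutant_commute hB (star_mem (h.implementsEquiv Q).1), hU,
    hU Q ⟨B x, hBx⟩, ampliation_tmul, ampliation_tmul,
    h.commutant_apply_symm_tmul hU hB _ x ⟨B x, hBx⟩ rfl]

end VonNeumannAlgebra.IsMatrixUnits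

theorem mainTheorem6 {H : Type*} [NormedAddCommGroup H] [InnerProductSpace ℂ H] [CompleteSpace H]
    [TopologicalSpace.SeparableSpace H] (A : VonNeumannAlgebra H) (hA : A.IsTypeIFactor) :
    (∃! n : ℕ∞, A.IsTypeIFactorOfIndex n) ∧
    ∀ n : ℕ∞, A.IsTypeIFactorOfIndex n → ∀ P : H →L[ℂ] H, A.IsMinimalProjector P →
      (∃ F : Set (H →L[ℂ] H), Maximal (A.IsOrthogonalCopies P) F) ∧
      ∀ F : Set (H →L[ℂ] H), Maximal (A.IsOrthogonalCopies P) F →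
        F.Countable ∧ F.encard = n ∧
        (∀ Q ∈ F, A.IsMinimalProjector Q) ∧
        (∀ x : H, HasSum (fun Q : F => (Q : H →L[ℂ] H) x) x) ∧
        ∀ V : F → (H →L[ℂ] H), (∀ Q : F, A.ImplementsEquiv (V Q) Q P) →
          (∀ T ∈ A, ∀ Q R : F, ∃ c : ℂ, V Q * T * star (V R) = c • P) ∧
          ∃ U : H ≃ₗᵢ[ℂ] HilbertTensor.Space (LabelSpace F) P.range,
            (∀ (Q : F) (x : P.range),
              U (star (V Q) (x : H)) = HilbertTensor.tmul (labelVector Q) x) ∧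
            {S | ∃ T ∈ A, ∀ z, S z = U (T (U.symm z))} =
              Set.range (HilbertTensor.ampliation (E := LabelSpace F) P.range) := by
  obtain ⟨hfac, P₀, hP₀⟩ := hA
  refine ⟨?_, ?_⟩
  · obtain ⟨F, hF⟩ := VonNeumannAlgebra.exists_maximal_isOrthogonalMinimalSet A
    refine ⟨F.encard, ⟨⟨hfac, P₀, hP₀⟩, F, hF, rfl⟩, ?_⟩
    rintro _ ⟨_, G, hG, rfl⟩
    exact hfac.encard_eq hP₀ hG hF
  · rintro _ ⟨_, G, hG, rfl⟩ P hP
    rw [hfac.isOrthogonalCopies_eq hP]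
    refine ⟨VonNeumannAlgebra.exists_maximal_isOrthogonalMinimalSet A, fun F hF =>
      ⟨hF.prop.countable, hfac.encard_eq hP hF hG, hF.prop.1, hfac.hasSum_apply hP hF,
        fun V hV => ?_⟩⟩
    have h : A.IsMatrixUnits P F V := ⟨hfac, hP, hF, hV⟩
    refine ⟨fun T hT Q R => (hV Q).exists_mul_mul_eq_smul (hV R) hP hT, ?_⟩
    have := h.completeSpace_range
    obtain ⟨U, hU⟩ := HilbertTensor.exists_linearIsometryEquiv h.isHilbertSum
    refine ⟨U, hU, Set.Subset.antisymm ?_ ?_⟩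
    · rintro S ⟨T, hT, hS⟩
      exact h.exists_ampliation_eq hU hT hS
    · rintro _ ⟨S₀, rfl⟩
      exact h.exists_mem_of_ampliation hU S₀
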